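/- Let $c_0, c_1, c_2, \dots$ be the following configurations on $\mathbb{R}/\mathbb{Z}$ (identified with $[0,1)$), each being a partial red-blue colouring together with a partition of the uncoloured set into directed open intervals. In $c_0$, $[0,1/4]$ is red, $[1/2,3/4]$ is blue, $(1/4,1/2)$ is an uncoloured interval with direction $+1$ and $(3/4,1)$ is an uncoloured interval with direction $-1$. To obtain $c_{i+1}$ from $c_i$, treat every uncoloured interval $(a,b)$ of $c_i$, with direction $\epsilon$, as follows. Put $f(x)=a+(b-a)x$ if $\epsilon=+1$ and $f(x)=b-(b-a)x$ if $\epsilon=-1$. Colour $f([1/5,2/5])$ blue and $f([3/5,4/5])$ red; the intervals $f((0,1/5))$ and $f((4/5,1))$ stay uncoloured with direction $\epsilon$, and $f((2/5,3/5))$ stays uncoloured with direction $-\epsilon$. Let $c_\infty$ be the partial colouring in which a point is red (respectively blue) if it is red (respectively blue) in some $c_i$. In a partially coloured abelian group, an $(a,b)$-AP is an arithmetic progression $x, x+d, \dots, x+(a+b-1)d$ such that none of the first $a$ terms is blue and none of the last $b$ terms is red; in a full colouring this says that the first $a$ terms are red and the last $b$ terms are blue. For a real number $\delta$, say that $(a,b)$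 is findable at density $\delta$ if there is $p_0$ such that for every prime $p\ge p_0$, every red-blue colouring of $\mathbb{Z}/p\mathbb{Z}$ in which each colour class has size at least $\delta p$ contains an $(a,b)$-AP with common difference $d\neq 0$; say that $(a,b)$ is findable if it is findable at density $\delta$ for every $\delta>0$. Theorem. (1) $c_\infty$ contains no $(14,14)$-AP with common difference $d\in(-1/2,0)\cup(0,1/2)$ (modulo $1$). (2) Let $c'_\infty$ be any full red-blue colouring of $\mathbb{R}/\mathbb{Z}$ obtained from $c_\infty$ by colouring the uncoloured points arbitrarily. Then $c'_\infty$ contains no $(14,14)$-AP. For every prime $p$, the colouring of $\mathbb{Z}/p\mathbb{Z}$ induced by $c'_\infty$ through $x\mapsto x/p$ contains no $(14,14)$-AP. The proportions of red and of blue points in these induced colourings both tend to $1/2$ as $p\to\infty$ through the primes. (3) Consequently, for every real $\delta<1/2$ (arbitrarily close to $1/2$), $(14,14)$ is not findable at density $\delta$; in particular, $(14,14)$ is not findable. -/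

import Mathlib

open Filter Topology

noncomputable section

namespace FractalColouring

/-- The two colours. -/
inductive Colour
  | red
  | blue

/-- A partial colouring: `none` means that the point is uncoloured. -/
abbrev PartialColouring (X : Type*) := X → Option Colour

/-- In a partially coloured abelian group: there is an arithmetic progression
`x, x + d, …, x + (a + b - 1) d` none of whose first `a` terms is blue and none of whose last `b`
terms is red. -/
def HasPartialAP {G : Type*} [AddCommGroup G] (c : PartialColouring G) (a b : ℕ) (d : G) : Prop :=
  ∃ x : G, (∀ i : ℕ, i < a → c (x + i • d) ≠ some Colour.blue) ∧
    (∀ i : ℕ, a ≤ i → i < a + b → c (x + i • d) ≠ some Colour.red)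

/-- In a fully coloured abelian group: there is an arithmetic progression
`x, x + d, …, x + (a + b - 1) d` whose first `a` terms are red and whose last `b` terms are
blue. -/
def HasAP {G : Type*} [AddCommGroup G] (c : G → Colour) (a b : ℕ) (d : G) : Prop :=
  ∃ x : G, (∀ i : ℕ, i < a → c (x + i • d) = Colour.red) ∧
    (∀ i : ℕ, a ≤ i → i < a + b → c (x + i • d) = Colour.blue)

/-- `(a, b)` is findable at density `δ`: for all large primes `p`, every red-blue colouring of
`ℤ/pℤ` with both colour classes of size at least `δ p` contains an `(a, b)`-progression with
nonzero common difference. -/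
def FindableAt (δ : ℝ) (a b : ℕ) : Prop :=
  ∃ p₀ : ℕ, ∀ p : ℕ, p.Prime → p₀ ≤ p → ∀ c : ZMod p → Colour,
    (∀ k : Colour, δ * (p : ℝ) ≤ (Nat.card {x : ZMod p // c x = k} : ℝ)) →
      ∃ d : ZMod p, d ≠ 0 ∧ HasAP c a b d

/-- `(a, b)` is findable. -/
def Findable (a b : ℕ) : Prop := ∀ δ : ℝ, 0 < δ → FindableAt δ a b

/-- An open interval `(left, right)` of length at most `1`, with a direction `+1` or `-1`. -/
@[ext] structure DirectedInterval where
  left : ℝ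
  right : ℝ
  dir : ℤˣ
  left_lt_right : left < right
  right_le : right ≤ left + 1

namespace DirectedInterval

/-- The points of `ℝ/ℤ` in the interval. -/
def arc (I : DirectedInterval) : Set UnitAddCircle :=
  (fun y : ℝ => (y : UnitAddCircle)) '' Set.Ioo I.left I.right

/-- The affine parametrisation of the closed interval by `[0, 1]`, run through in the direction of
the interval. -/
def param (I : DirectedInterval) (t : ℝ) : ℝ :=
  if I.dir = 1 then I.left + (I.right - I.left) * t else I.right - (I.right - I.left) * t

/-- The image in `ℝ/ℤ` of a set of parameters. -/
def part (I : DirectedInterval) (S : Set ℝ) : Set UnitAddCircle :=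
  (fun t : ℝ => (I.param t : UnitAddCircle)) '' S

theorem abs_param_sub (I : DirectedInterval) (s t : ℝ) :
    |I.param s - I.param t| = (I.right - I.left) * |s - t| := by
  have h : 0 < I.right - I.left := sub_pos.mpr I.left_lt_right
  unfold param
  split_ifs
  · rw [show I.left + (I.right - I.left) * s - (I.left + (I.right - I.left) * t)
      = (I.right - I.left) * (s - t) by ring, abs_mul, abs_of_pos h]
  · rw [show I.right - (I.right - I.left) * s - (I.right - (I.right - I.left) * t)
      = -((I.right - I.left) * (s - t)) by ring, abs_neg, abs_mul, abs_of_pos h]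

/-- The subinterval that is the image of the parameter interval `(s, t)`, with direction `e`. -/
def sub (I : DirectedInterval) (s t : ℝ) (hs : 0 ≤ s) (hst : s < t) (ht : t ≤ 1) (e : ℤˣ) :
    DirectedInterval where
  left := min (I.param s) (I.param t)
  right := max (I.param s) (I.param t)
  dir := e
  left_lt_right := by
    have h : 0 < I.right - I.left := sub_pos.mpr I.left_lt_right
    have h1 := I.abs_param_sub s t
    rw [min_lt_max]
    intro h2
    rw [h2, sub_self, abs_zero] at h1
    have : 0 < |s - t| := abs_pos.mpr (by linarith)
    nlinarith
  right_le := by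
    have h : 0 < I.right - I.left := sub_pos.mpr I.left_lt_right
    have h1 := I.abs_param_sub s t
    have h2 := max_sub_min_eq_abs (I.param s) (I.param t)
    have h3 := I.right_le
    have h4 : |s - t| ≤ 1 := by rw [abs_le]; constructor <;> linarith
    have h5 := abs_sub_comm (I.param s) (I.param t)
    have h6 : (I.right - I.left) * |s - t| ≤ 1 := by
      nlinarith [abs_nonneg (s - t)]
    linarith

/-- The image of `(0, 1/5)`, in the same direction. -/
def first (I : DirectedInterval) : DirectedInterval :=
  I.sub 0 (1 / 5) (by norm_num) (by norm_num) (by norm_num) I.dir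

/-- The image of `(2/5, 3/5)`, in the opposite direction. -/
def middle (I : DirectedInterval) : DirectedInterval :=
  I.sub (2 / 5) (3 / 5) (by norm_num) (by norm_num) (by norm_num) (-I.dir)

/-- The image of `(4/5, 1)`, in the same direction. -/
def last (I : DirectedInterval) : DirectedInterval :=
  I.sub (4 / 5) 1 (by norm_num) (by norm_num) (by norm_num) I.dir

theorem param_image_Ioo (I : DirectedInterval) (s t : ℝ) (hst : s < t) :
    I.param '' Set.Ioo s t = Set.Ioo (min (I.param s) (I.param t)) (max (I.param s) (I.param t)) := by
  have h : 0 < I.right - I.left := sub_pos.mpr I.left_lt_right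
  unfold param
  split_ifs
  · have h1 : I.left + (I.right - I.left) * s < I.left + (I.right - I.left) * t := by nlinarith
    rw [min_eq_left h1.le, max_eq_right h1.le]
    ext y
    constructor
    · rintro ⟨u, ⟨hu1, hu2⟩, rfl⟩
      constructor <;> dsimp only <;> nlinarith
    · rintro ⟨hy1, hy2⟩
      refine ⟨(y - I.left) / (I.right - I.left), ⟨?_, ?_⟩, ?_⟩
      · rw [lt_div_iff₀ h]; linarith
      · rw [div_lt_iff₀ h]; linarith
      · dsimp only; field_simp; ring
  · have h1 : I.right - (I.right - I.left) * t < I.right - (I.right - I.left) * s := by nlinarith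
    rw [min_eq_right h1.le, max_eq_left h1.le]
    ext y
    constructor
    · rintro ⟨u, ⟨hu1, hu2⟩, rfl⟩
      constructor <;> dsimp only <;> nlinarith
    · rintro ⟨hy1, hy2⟩
      refine ⟨(I.right - y) / (I.right - I.left), ⟨?_, ?_⟩, ?_⟩
      · rw [lt_div_iff₀ h]; linarith
      · rw [div_lt_iff₀ h]; linarith
      · dsimp only; field_simp; ring

theorem arc_sub (I : DirectedInterval) (s t : ℝ) (hs : 0 ≤ s) (hst : s < t) (ht : t ≤ 1)
    (e : ℤˣ) : (I.sub s t hs hst ht e).arc = I.part (Set.Ioo s t) := by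
  unfold arc part sub
  dsimp only
  rw [← I.param_image_Ioo s t hst, Set.image_image]

theorem arc_eq_part (I : DirectedInterval) : I.arc = I.part (Set.Ioo 0 1) := by
  have h := I.left_lt_right
  unfold arc part
  rw [← Set.image_image (fun y : ℝ => (y : UnitAddCircle)) I.param,
    I.param_image_Ioo 0 1 one_pos]
  congr 2
  · unfold param; split_ifs <;> simp [h.le]
  · unfold param; split_ifs <;> simp [h.le]

theorem part_mono (I : DirectedInterval) {S T : Set ℝ} (h : S ⊆ T) : I.part S ⊆ I.part T :=
  Set.image_mono h

theorem param_injOn (I : DirectedInterval) :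
    Set.InjOn (fun t : ℝ => (I.param t : UnitAddCircle)) (Set.Ioo 0 1) := by
  intro s hs t ht hst
  have hpos : 0 < I.right - I.left := sub_pos.mpr I.left_lt_right
  have key : ∀ u ∈ Set.Ioo (0 : ℝ) 1, I.param u ∈ Set.Ico I.left (I.left + 1) := by
    intro u hu
    have h3 := I.right_le
    obtain ⟨hu1, hu2⟩ := hu
    unfold param
    split_ifs <;> constructor <;> nlinarith
  have h1 := (AddCircle.coe_eq_coe_iff_of_mem_Ico (key s hs) (key t ht)).mp hst
  have h2 := I.abs_param_sub s t
  rw [h1, sub_self, abs_zero] at h2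
  have h3 : |s - t| = 0 := by
    rcases mul_eq_zero.mp h2.symm with h | h
    · exact absurd h hpos.ne'
    · exact h
  linarith [abs_eq_zero.mp h3]

end DirectedInterval

/-- A configuration: a partial colouring of `ℝ/ℤ` together with a partition of the uncoloured
set into directed intervals. -/
structure Configuration where
  colour : PartialColouring UnitAddCircle
  intervals : Set DirectedInterval
  uncoloured_iff : ∀ x, colour x = none ↔ ∃ I ∈ intervals, x ∈ I.arc
  disjoint : ∀ I ∈ intervals, ∀ J ∈ intervals, ∀ x, x ∈ I.arc → x ∈ J.arc → I = J

/-- The uncoloured interval `(1/4, 1/2)`, with direction `+1`. -/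
def initialForward : DirectedInterval := ⟨1 / 4, 1 / 2, 1, by norm_num, by norm_num⟩

/-- The uncoloured interval `(3/4, 1)`, with direction `-1`. -/
def initialBackward : DirectedInterval := ⟨3 / 4, 1, -1, by norm_num, by norm_num⟩

open Classical in
/-- The initial partial colouring: `[0, 1/4]` red, `[1/2, 3/4]` blue, the rest uncoloured. -/
def initialColour : PartialColouring UnitAddCircle := fun x =>
  if x ∈ (fun y : ℝ => (y : UnitAddCircle)) '' Set.Icc 0 (1 / 4) then some Colour.red
  else if x ∈ (fun y : ℝ => (y : UnitAddCircle)) '' Set.Icc (1 / 2) (3 / 4) then some Colour.blue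
  else none

theorem coe_mem_image_iff {y : ℝ} (hy : y ∈ Set.Ico (0 : ℝ) 1) {S : Set ℝ}
    (hS : S ⊆ Set.Ico 0 1) :
    (y : UnitAddCircle) ∈ (fun z : ℝ => (z : UnitAddCircle)) '' S ↔ y ∈ S := by
  constructor
  · rintro ⟨z, hz, hzy⟩
    have := (AddCircle.coe_eq_coe_iff_of_mem_Ico (p := (1 : ℝ)) (a := 0)
      (by simpa using hS hz) (by simpa using hy)).mp hzy
    rwa [← this]
  · intro h
    exact ⟨y, h, rfl⟩

theorem exists_rep (x : UnitAddCircle) : ∃ y ∈ Set.Ico (0 : ℝ) 1, (y : UnitAddCircle) = x := by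
  obtain ⟨y, hy, rfl⟩ := (AddCircle.coe_image_Ico_eq (1 : ℝ) 0).ge (Set.mem_univ x)
  exact ⟨y, by simpa using hy, rfl⟩

/-- The configuration `c₀`. -/
def initial : Configuration where
  colour := initialColour
  intervals := {initialForward, initialBackward}
  uncoloured_iff := by
    intro x
    obtain ⟨y, hy, rfl⟩ := exists_rep x
    have h1 : Set.Icc (0 : ℝ) (1 / 4) ⊆ Set.Ico 0 1 := fun z hz =>
      ⟨hz.1, lt_of_le_of_lt hz.2 (by norm_num)⟩
    have h2 : Set.Icc (1 / 2 : ℝ) (3 / 4) ⊆ Set.Ico 0 1 := fun z hz =>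
      ⟨le_trans (by norm_num) hz.1, lt_of_le_of_lt hz.2 (by norm_num)⟩
    have h3 : Set.Ioo (1 / 4 : ℝ) (1 / 2) ⊆ Set.Ico 0 1 := fun z hz =>
      ⟨le_trans (by norm_num) hz.1.le, lt_trans hz.2 (by norm_num)⟩
    have h4 : Set.Ioo (3 / 4 : ℝ) 1 ⊆ Set.Ico 0 1 := fun z hz =>
      ⟨le_trans (by norm_num) hz.1.le, hz.2⟩
    simp only [Set.mem_insert_iff, Set.mem_singleton_iff, exists_eq_or_imp, exists_eq_left,
      DirectedInterval.arc, initialForward, initialBackward, initialColour]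
    rw [coe_mem_image_iff hy h1, coe_mem_image_iff hy h2, coe_mem_image_iff hy h3,
      coe_mem_image_iff hy h4]
    simp only [Set.mem_Icc, Set.mem_Ioo]
    obtain ⟨hy0, hy1⟩ := hy
    split_ifs with ha hb
    · simp only [reduceCtorEq, false_iff, not_or, not_and, not_lt]
      constructor <;> intros <;> linarith [ha.2]
    · simp only [reduceCtorEq, false_iff, not_or, not_and, not_lt]
      constructor <;> intros <;> linarith [hb.1, hb.2]
    · simp only [true_iff]
      by_cases hc : y < 1 / 2
      · left
        exact ⟨lt_of_not_ge fun h => ha ⟨hy0, h⟩, hc⟩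
      · right
        exact ⟨lt_of_not_ge fun h => hb ⟨not_lt.mp hc, h⟩, hy1⟩
  disjoint := by
    have h3 : Set.Ioo (1 / 4 : ℝ) (1 / 2) ⊆ Set.Ico 0 1 := fun z hz =>
      ⟨le_trans (by norm_num) hz.1.le, lt_trans hz.2 (by norm_num)⟩
    have h4 : Set.Ioo (3 / 4 : ℝ) 1 ⊆ Set.Ico 0 1 := fun z hz =>
      ⟨le_trans (by norm_num) hz.1.le, hz.2⟩
    have key : ∀ x, x ∈ initialForward.arc → x ∈ initialBackward.arc → False := by
      intro x hx hx'
      obtain ⟨y, hy, rfl⟩ := exists_rep x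
      have a1 := (coe_mem_image_iff hy h3).mp hx
      have a2 := (coe_mem_image_iff hy h4).mp hx'
      linarith [a1.2, a2.1]
    rintro I (rfl | rfl) J (rfl | rfl) x hI hJ
    · rfl
    · exact (key x hI hJ).elim
    · exact (key x hJ hI).elim
    · rfl

open Classical in
/-- The colouring after one application of the replacement rule to all uncoloured intervals:
coloured points keep their colour, and in each uncoloured interval the images of `[1/5, 2/5]` and
`[3/5, 4/5]` become blue and red respectively. -/
def Configuration.nextColour (c : Configuration) : PartialColouring UnitAddCircle := fun x =>
  match c.colour x with
  | some k => some k
  | none =>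
    if ∃ I ∈ c.intervals, x ∈ I.part (Set.Icc (1 / 5) (2 / 5)) then some Colour.blue
    else if ∃ I ∈ c.intervals, x ∈ I.part (Set.Icc (3 / 5) (4 / 5)) then some Colour.red
    else none

/-- The uncoloured intervals after one application of the replacement rule. -/
def Configuration.nextIntervals (c : Configuration) : Set DirectedInterval :=
  {K | ∃ I ∈ c.intervals, K = I.first ∨ K = I.middle ∨ K = I.last}

theorem Configuration.mem_nextIntervals_arc (c : Configuration) {K : DirectedInterval}
    (hK : K ∈ c.nextIntervals) {x : UnitAddCircle} (hx : x ∈ K.arc) :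
    ∃ I ∈ c.intervals, ∃ t : ℝ, (I.param t : UnitAddCircle) = x ∧
      ((K = I.first ∧ 0 < t ∧ t < 1 / 5) ∨ (K = I.middle ∧ 2 / 5 < t ∧ t < 3 / 5) ∨
        (K = I.last ∧ 4 / 5 < t ∧ t < 1)) := by
  obtain ⟨I, hI, h | h | h⟩ := hK
  · rw [h, DirectedInterval.first, DirectedInterval.arc_sub] at hx
    obtain ⟨t, ht, rfl⟩ := hx
    exact ⟨I, hI, t, rfl, Or.inl ⟨h, ht.1, ht.2⟩⟩
  · rw [h, DirectedInterval.middle, DirectedInterval.arc_sub] at hx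
    obtain ⟨t, ht, rfl⟩ := hx
    exact ⟨I, hI, t, rfl, Or.inr (Or.inl ⟨h, ht.1, ht.2⟩)⟩
  · rw [h, DirectedInterval.last, DirectedInterval.arc_sub] at hx
    obtain ⟨t, ht, rfl⟩ := hx
    exact ⟨I, hI, t, rfl, Or.inr (Or.inr ⟨h, ht.1, ht.2⟩)⟩

theorem Configuration.param_unique (c : Configuration) {I J : DirectedInterval}
    (hI : I ∈ c.intervals) (hJ : J ∈ c.intervals) {s t : ℝ} (hs : s ∈ Set.Ioo (0 : ℝ) 1)
    (ht : t ∈ Set.Ioo (0 : ℝ) 1) (h : (I.param s : UnitAddCircle) = (J.param t : UnitAddCircle)) :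
    I = J ∧ s = t := by
  have h1 : (I.param s : UnitAddCircle) ∈ I.arc := by
    rw [I.arc_eq_part]; exact ⟨s, hs, rfl⟩
  have h2 : (I.param s : UnitAddCircle) ∈ J.arc := by
    rw [J.arc_eq_part, h]; exact ⟨t, ht, rfl⟩
  have h3 := c.disjoint I hI J hJ _ h1 h2
  subst h3
  exact ⟨rfl, I.param_injOn hs ht h⟩

/-- The configuration obtained by applying the replacement rule to all uncoloured intervals. -/
def Configuration.next (c : Configuration) : Configuration where
  colour := c.nextColour
  intervals := c.nextIntervals
  uncoloured_iff := by
    intro x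
    constructor
    · intro hx
      unfold nextColour at hx
      split at hx
      · exact absurd hx (by simp)
      · rename_i hnone
        obtain ⟨I, hI, hxI⟩ := (c.uncoloured_iff x).mp hnone
        split_ifs at hx with hb hr
        rw [I.arc_eq_part] at hxI
        obtain ⟨t, ⟨ht0, ht1⟩, rfl⟩ := hxI
        have hb' : ¬ (1 / 5 ≤ t ∧ t ≤ 2 / 5) := fun h => hb ⟨I, hI, t, h, rfl⟩
        have hr' : ¬ (3 / 5 ≤ t ∧ t ≤ 4 / 5) := fun h => hr ⟨I, hI, t, h, rfl⟩
        by_cases h1 : t < 1 / 5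
        · refine ⟨I.first, ⟨I, hI, Or.inl rfl⟩, ?_⟩
          rw [DirectedInterval.first, DirectedInterval.arc_sub]
          exact ⟨t, ⟨ht0, h1⟩, rfl⟩
        · have h2 : 2 / 5 < t := lt_of_not_ge fun h => hb' ⟨not_lt.mp h1, h⟩
          by_cases h3 : t < 3 / 5
          · refine ⟨I.middle, ⟨I, hI, Or.inr (Or.inl rfl)⟩, ?_⟩
            rw [DirectedInterval.middle, DirectedInterval.arc_sub]
            exact ⟨t, ⟨h2, h3⟩, rfl⟩
          · refine ⟨I.last, ⟨I, hI, Or.inr (Or.inr rfl)⟩, ?_⟩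
            rw [DirectedInterval.last, DirectedInterval.arc_sub]
            exact ⟨t, ⟨lt_of_not_ge fun h => hr' ⟨not_lt.mp h3, h⟩, ht1⟩, rfl⟩
    · rintro ⟨K, hK, hx⟩
      obtain ⟨I, hI, t, rfl, ht⟩ := c.mem_nextIntervals_arc hK hx
      have ht01 : t ∈ Set.Ioo (0 : ℝ) 1 := by
        rcases ht with ⟨-, h1, h2⟩ | ⟨-, h1, h2⟩ | ⟨-, h1, h2⟩ <;> constructor <;> linarith
      have hnone : c.colour (I.param t : UnitAddCircle) = none := by
        rw [c.uncoloured_iff]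
        refine ⟨I, hI, ?_⟩
        rw [I.arc_eq_part]
        exact ⟨t, ht01, rfl⟩
      unfold nextColour
      rw [hnone]
      dsimp only
      rw [if_neg, if_neg]
      · rintro ⟨J, hJ, s, ⟨hs1, hs2⟩, hsx⟩
        have hs01 : s ∈ Set.Ioo (0 : ℝ) 1 := by constructor <;> linarith
        obtain ⟨-, rfl⟩ := c.param_unique hJ hI hs01 ht01 hsx
        rcases ht with ⟨-, h1, h2⟩ | ⟨-, h1, h2⟩ | ⟨-, h1, h2⟩ <;> linarith
      · rintro ⟨J, hJ, s, ⟨hs1, hs2⟩, hsx⟩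
        have hs01 : s ∈ Set.Ioo (0 : ℝ) 1 := by constructor <;> linarith
        obtain ⟨-, rfl⟩ := c.param_unique hJ hI hs01 ht01 hsx
        rcases ht with ⟨-, h1, h2⟩ | ⟨-, h1, h2⟩ | ⟨-, h1, h2⟩ <;> linarith
  disjoint := by
    intro K hK L hL x hxK hxL
    obtain ⟨I, hI, s, rfl, hs⟩ := c.mem_nextIntervals_arc hK hxK
    obtain ⟨J, hJ, t, hts, ht⟩ := c.mem_nextIntervals_arc hL hxL
    have hs01 : s ∈ Set.Ioo (0 : ℝ) 1 := by
      rcases hs with ⟨-, h1, h2⟩ | ⟨-, h1, h2⟩ | ⟨-, h1, h2⟩ <;> constructor <;> linarith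
    have ht01 : t ∈ Set.Ioo (0 : ℝ) 1 := by
      rcases ht with ⟨-, h1, h2⟩ | ⟨-, h1, h2⟩ | ⟨-, h1, h2⟩ <;> constructor <;> linarith
    obtain ⟨rfl, rfl⟩ := c.param_unique hJ hI ht01 hs01 hts
    rcases hs with ⟨rfl, h1, h2⟩ | ⟨rfl, h1, h2⟩ | ⟨rfl, h1, h2⟩ <;>
      rcases ht with ⟨rfl, h3, h4⟩ | ⟨rfl, h3, h4⟩ | ⟨rfl, h3, h4⟩ <;>
      first | rfl | (exfalso; linarith)

/-- The configurations `c₀, c₁, c₂, …`. -/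
def config : ℕ → Configuration
  | 0 => initial
  | i + 1 => (config i).next

/-- Once a point is coloured, it keeps its colour. -/
theorem config_colour_mono {i j : ℕ} (hij : i ≤ j) {x : UnitAddCircle} {k : Colour}
    (h : (config i).colour x = some k) : (config j).colour x = some k := by
  induction hij with
  | refl => exact h
  | step _ ih =>
    change (config _).nextColour x = some k
    unfold Configuration.nextColour
    rw [ih]

open Classical in
/-- The limiting partial colouring `c_∞`. The two cases exclude each other, see
`limitColour_eq_some_iff`. -/
def limitColour : PartialColouring UnitAddCircle := fun x =>
  if ∃ i, (config i).colour x = some Colour.red then some Colour.red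
  else if ∃ i, (config i).colour x = some Colour.blue then some Colour.blue
  else none

theorem limitColour_eq_some_iff (x : UnitAddCircle) (k : Colour) :
    limitColour x = some k ↔ ∃ i, (config i).colour x = some k := by
  have key : ∀ i j : ℕ, (config i).colour x = some Colour.red →
      (config j).colour x = some Colour.blue → False := by
    intro i j hi hj
    have h1 := config_colour_mono (le_max_left i j) hi
    have h2 := config_colour_mono (le_max_right i j) hj
    rw [h1] at h2
    simp at h2
  unfold limitColour
  split_ifs with hr hb
  · obtain ⟨i, hi⟩ := hr
    cases k with
    | red => exact ⟨fun _ => ⟨i, hi⟩, fun _ => rfl⟩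
    | blue => exact ⟨fun h => by simp at h, fun ⟨j, hj⟩ => (key i j hi hj).elim⟩
  · cases k with
    | red => exact ⟨fun h => by simp at h, fun h => (hr h).elim⟩
    | blue => exact ⟨fun _ => hb, fun _ => rfl⟩
  · cases k with
    | red => exact ⟨fun h => by simp at h, fun h => (hr h).elim⟩
    | blue => exact ⟨fun h => by simp at h, fun h => (hb h).elim⟩

/-- The full colouring `c'` is obtained from the partial colouring `c` by colouring the uncoloured
points in some way. -/
def Extends {X : Type*} (c' : X → Colour) (c : PartialColouring X) : Prop :=
  ∀ x k, c x = some k → c' x = k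

/-- The colouring of `ℤ/pℤ` induced by a colouring of `ℝ/ℤ` through `x ↦ x / p`. -/
def induced (p : ℕ) (c : UnitAddCircle → Colour) : ZMod p → Colour := fun x =>
  c (((x.val : ℝ) / (p : ℝ) : ℝ) : UnitAddCircle)

/-- The proportion of points of `ℤ/pℤ` of a given colour. -/
def density (p : ℕ) (c : ZMod p → Colour) (k : Colour) : ℝ :=
  (Nat.card {x : ZMod p // c x = k} : ℝ) / (p : ℝ)

end FractalColouring

end

namespace FractalColouring

/-! On the real line every uncoloured interval ("gap") lies between a block of one colour `k` and a
block of the other. Described by the colour on its left, the replacement rule no longer mentions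
directions: from left to right, a gap becomes gap, block of colour `k.swap`, gap, block of colour
`k`, gap. `Gap` and `Col` record this picture. Two features carry the proof: a half turn exchanges
the colours (`Col.add_half`), and each gap of level `i` has an oppositely oriented gap of the same
length at distance `2 * scale i` (`Gap.neighbour`).

After reversing the progression if necessary, the step satisfies `0 < d < 1/2`, and three ranges
remain.

For `d < 1/4`, choose `i` with `scale (i + 1) ≤ d < scale i`. The colour change straddles a gap of
level `i` (`exists_straddled_gap`). Such steps cannot cross a forbidden block of length `scale i`,
so one half of the progression is trapped in a short window, either a single gap or two neighbouring
gaps with the block between them. Steps of at least `scale i / 5` are too long for 14 terms to fit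
there (`not_fits`).

For `1/4 ≤ d ≤ 3/8`, the blocks of level 0 suffice: three steps make about one turn, so three
consecutive terms would have to straddle first the blue block and soon afterwards the opposite red
block.

For `3/8 < d < 1/2`, half turns replace the step by the small number `d - 1/2` at the price of
alternating the colours. Consecutive points then share no colour, so they avoid long blocks and
crowd into one gap that is too short for them (`exists_common_gap`).

The induced colourings inherit the absence of progressions because `x ↦ x / p` is a homomorphism.
Their densities tend to `1/2` because each round colours equal parts of every gap red and blue and
leaves only `3/5` of it uncoloured. -/

/-- The other colour. -/
def Colour.swap : Colour → Colour
  | .red => .blue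
  | .blue => .red

@[simp] theorem Colour.swap_swap (k : Colour) : k.swap.swap = k := by cases k <;> rfl

theorem Colour.eq_or_eq_swap (k l : Colour) : l = k ∨ l = k.swap := by
  cases k <;> cases l <;> simp [Colour.swap]

/-! ### Gaps and blocks on the real line -/

/-- The common length of the uncoloured intervals of `config i`. -/
noncomputable def scale (i : ℕ) : ℝ := 1 / 4 * (1 / 5) ^ i

theorem scale_zero : scale 0 = 1 / 4 := by simp [scale]

theorem scale_succ (i : ℕ) : scale (i + 1) = scale i / 5 := by
  unfold scale; rw [pow_succ]; ring

theorem scale_pos (i : ℕ) : 0 < scale i := by unfold scale; positivity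

theorem exists_scale_le_lt {d : ℝ} (h0 : 0 < d) (h1 : d < 1 / 4) :
    ∃ i, scale (i + 1) ≤ d ∧ d < scale i := by
  classical
  have hex : ∃ n, scale n ≤ d := by
    obtain ⟨n, hn⟩ := exists_pow_lt_of_lt_one h0 (by norm_num : (1 / 5 : ℝ) < 1)
    refine ⟨n, ?_⟩
    have : (0 : ℝ) < (1 / 5) ^ n := by positivity
    unfold scale; linarith
  have hpos : Nat.find hex ≠ 0 := by
    intro h
    have := Nat.find_spec hex
    rw [h, scale_zero] at this
    linarith
  obtain ⟨i, hi⟩ := Nat.exists_eq_succ_of_ne_zero hpos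
  refine ⟨i, ?_, ?_⟩
  · have := Nat.find_spec hex
    rwa [hi] at this
  · exact not_le.mp (Nat.find_min hex (by omega))

/-- `Gap i k a`: the lift to `ℝ` of `config i` has an uncoloured interval `(a, a + scale i)` whose
left neighbour has colour `k` and whose right neighbour has the other colour. -/
inductive Gap : ℕ → Colour → ℝ → Prop
  | red (n : ℤ) : Gap 0 .red (1 / 4 + n)
  | blue (n : ℤ) : Gap 0 .blue (3 / 4 + n)
  | first {i k a} : Gap i k a → Gap (i + 1) k a
  | middle {i k a} : Gap i k a → Gap (i + 1) k.swap (a + 2 / 5 * scale i)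
  | last {i k a} : Gap i k a → Gap (i + 1) k (a + 4 / 5 * scale i)

/-- `Col k y`: the real number `y` has colour `k` in the lift to `ℝ` of the limit colouring. -/
inductive Col : Colour → ℝ → Prop
  | red (n : ℤ) {y : ℝ} : n ≤ y → y ≤ n + 1 / 4 → Col .red y
  | blue (n : ℤ) {y : ℝ} : n + 1 / 2 ≤ y → y ≤ n + 3 / 4 → Col .blue y
  | left {i k a y} : Gap i k a → a + 1 / 5 * scale i ≤ y → y ≤ a + 2 / 5 * scale i → Col k.swap y
  | right {i k a y} : Gap i k a → a + 3 / 5 * scale i ≤ y → y ≤ a + 4 / 5 * scale i → Col k y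

/-! ### Comparison with the configurations on the circle -/

/-- The direction of an uncoloured interval whose left neighbour has a given colour. -/
def Colour.dir : Colour → ℤˣ
  | .red => 1
  | .blue => -1

theorem Colour.dir_swap (k : Colour) : k.swap.dir = -k.dir := by cases k <;> simp [swap, dir]

theorem DirectedInterval.param_red {I : DirectedInterval} (h : I.dir = Colour.red.dir) (t : ℝ) :
    I.param t = I.left + (I.right - I.left) * t := by
  simp [param, h, Colour.dir]

theorem DirectedInterval.param_blue {I : DirectedInterval} (h : I.dir = Colour.blue.dir) (t : ℝ) :
    I.param t = I.right - (I.right - I.left) * t := by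
  have : (-1 : ℤˣ) ≠ 1 := by decide
  simp [param, h, Colour.dir, this]

/-- The integer `n` is needed because a configuration stores one representative of each gap modulo
1. -/
theorem Gap.exists_interval {i : ℕ} {k : Colour} {a : ℝ} (h : Gap i k a) :
    ∃ I ∈ (config i).intervals, ∃ n : ℤ, I.left = a + n ∧ I.right = a + n + scale i ∧
      I.dir = k.dir := by
  induction h with
  | red n =>
    refine ⟨initialForward, Or.inl rfl, -n, ?_, ?_, rfl⟩
    · simp [initialForward]
    · simp [initialForward, scale_zero]; norm_num
  | blue n =>
    refine ⟨initialBackward, Or.inr rfl, -n, ?_, ?_, rfl⟩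
    · simp [initialBackward]
    · simp [initialBackward, scale_zero]; norm_num
  | @first i k a _ ih =>
    obtain ⟨I, hI, n, hl, hr, hd⟩ := ih
    have hs := scale_pos i
    have hs' := scale_succ i
    cases k with
    | red =>
      refine ⟨I.first, ⟨I, hI, Or.inl rfl⟩, n, ?_, ?_, hd⟩
      · simp only [DirectedInterval.first, DirectedInterval.sub, I.param_red hd, hl, hr]
        rw [min_eq_left] <;> linarith
      · simp only [DirectedInterval.first, DirectedInterval.sub, I.param_red hd, hl, hr]
        rw [max_eq_right] <;> linarith
    | blue =>
      -- With blue on the left the parametrisation runs from right to left, so the leftmost fifth is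
      -- the last one.
      refine ⟨I.last, ⟨I, hI, Or.inr (Or.inr rfl)⟩, n, ?_, ?_, hd⟩
      · simp only [DirectedInterval.last, DirectedInterval.sub, I.param_blue hd, hl, hr]
        rw [min_eq_right] <;> linarith
      · simp only [DirectedInterval.last, DirectedInterval.sub, I.param_blue hd, hl, hr]
        rw [max_eq_left] <;> linarith
  | @middle i k a _ ih =>
    obtain ⟨I, hI, n, hl, hr, hd⟩ := ih
    have hs := scale_pos i
    have hs' := scale_succ i
    refine ⟨I.middle, ⟨I, hI, Or.inr (Or.inl rfl)⟩, n, ?_, ?_, ?_⟩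
    · simp only [DirectedInterval.middle, DirectedInterval.sub]
      cases k with
      | red => simp only [I.param_red hd, hl, hr]; rw [min_eq_left] <;> linarith
      | blue => simp only [I.param_blue hd, hl, hr]; rw [min_eq_right] <;> linarith
    · simp only [DirectedInterval.middle, DirectedInterval.sub]
      cases k with
      | red => simp only [I.param_red hd, hl, hr]; rw [max_eq_right] <;> linarith
      | blue => simp only [I.param_blue hd, hl, hr]; rw [max_eq_left] <;> linarith
    · simp only [DirectedInterval.middle, DirectedInterval.sub, hd, Colour.dir_swap]
  | @last i k a _ ih =>
    obtain ⟨I, hI, n, hl, hr, hd⟩ := ih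
    have hs := scale_pos i
    have hs' := scale_succ i
    cases k with
    | red =>
      refine ⟨I.last, ⟨I, hI, Or.inr (Or.inr rfl)⟩, n, ?_, ?_, hd⟩
      · simp only [DirectedInterval.last, DirectedInterval.sub, I.param_red hd, hl, hr]
        rw [min_eq_left] <;> linarith
      · simp only [DirectedInterval.last, DirectedInterval.sub, I.param_red hd, hl, hr]
        rw [max_eq_right] <;> linarith
    | blue =>
      refine ⟨I.first, ⟨I, hI, Or.inl rfl⟩, n, ?_, ?_, hd⟩
      · simp only [DirectedInterval.first, DirectedInterval.sub, I.param_blue hd, hl, hr]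
        rw [min_eq_right] <;> linarith
      · simp only [DirectedInterval.first, DirectedInterval.sub, I.param_blue hd, hl, hr]
        rw [max_eq_left] <;> linarith

theorem coe_add_intCast (y : ℝ) (n : ℤ) : ((y + n : ℝ) : UnitAddCircle) = y := by
  rw [AddCircle.coe_add]
  have : ((n : ℝ) : UnitAddCircle) = 0 :=
    (AddCircle.coe_eq_zero_iff (1 : ℝ)).mpr ⟨n, by simp⟩
  rw [this, add_zero]

theorem Configuration.nextColour_param (c : Configuration) {I : DirectedInterval}
    (hI : I ∈ c.intervals) {t : ℝ} (ht : t ∈ Set.Ioo (0 : ℝ) 1) :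
    (t ∈ Set.Icc (1 / 5) (2 / 5) → c.nextColour (I.param t) = some .blue) ∧
      (t ∈ Set.Icc (3 / 5) (4 / 5) → c.nextColour (I.param t) = some .red) := by
  have hnone : c.colour (I.param t : UnitAddCircle) = none := by
    rw [c.uncoloured_iff]
    refine ⟨I, hI, ?_⟩
    rw [I.arc_eq_part]
    exact ⟨t, ht, rfl⟩
  unfold nextColour
  rw [hnone]
  dsimp only
  constructor
  · intro h
    rw [if_pos ⟨I, hI, t, h, rfl⟩]
  · intro h
    rw [if_neg, if_pos ⟨I, hI, t, h, rfl⟩]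
    rintro ⟨J, hJ, s, hs, hst⟩
    obtain ⟨-, rfl⟩ := c.param_unique hJ hI ⟨by linarith [hs.1], by linarith [hs.2]⟩ ht hst
    linarith [hs.2, h.1]

/-- In both orientations the parameter `t` is measured from the red end of the gap. -/
theorem Gap.exists_param {i : ℕ} {k : Colour} {a : ℝ} (h : Gap i k a) (y : ℝ) :
    ∃ I ∈ (config i).intervals, ∃ t : ℝ, (I.param t : UnitAddCircle) = y ∧
      ((k = .red ∧ y = a + t * scale i) ∨ (k = .blue ∧ y = a + (1 - t) * scale i)) := by
  obtain ⟨I, hI, n, hl, hr, hd⟩ := h.exists_interval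
  have hs := scale_pos i
  cases k with
  | red =>
    refine ⟨I, hI, (y - a) / scale i, ?_, Or.inl ⟨rfl, ?_⟩⟩
    · rw [I.param_red hd, hl, hr, ← coe_add_intCast y n]
      congr 1; field_simp; ring
    · field_simp; ring
  | blue =>
    refine ⟨I, hI, 1 - (y - a) / scale i, ?_, Or.inr ⟨rfl, ?_⟩⟩
    · rw [I.param_blue hd, hl, hr, ← coe_add_intCast y n]
      congr 1; field_simp; ring
    · field_simp; ring

/-- This one implication is the only link needed: excluding progressions and bounding densities from
below both require only enough coloured points. -/
theorem Col.limitColour_eq {k : Colour} {y : ℝ} (h : Col k y) :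
    limitColour (y : UnitAddCircle) = some k := by
  rw [limitColour_eq_some_iff]
  cases h with
  | red n h1 h2 =>
    refine ⟨0, ?_⟩
    change initialColour _ = _
    unfold initialColour
    rw [if_pos]
    refine ⟨y - n, ⟨by linarith, by linarith⟩, ?_⟩
    dsimp only
    rw [← coe_add_intCast (y - n) n, sub_add_cancel]
  | blue n h1 h2 =>
    refine ⟨0, ?_⟩
    change initialColour _ = _
    unfold initialColour
    have hy : (y : UnitAddCircle) = ((y - n : ℝ) : UnitAddCircle) := by
      rw [← coe_add_intCast (y - n) n, sub_add_cancel]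
    have hmem : y - n ∈ Set.Ico (0 : ℝ) 1 := ⟨by linarith, by linarith⟩
    rw [hy, coe_mem_image_iff hmem, coe_mem_image_iff hmem, if_neg, if_pos]
    · exact ⟨by linarith, by linarith⟩
    · rintro ⟨-, h⟩; linarith
    · exact fun z hz => ⟨by linarith [hz.1], by linarith [hz.2]⟩
    · exact fun z hz => ⟨by linarith [hz.1], by linarith [hz.2]⟩
  | @left i l a _ hg h1 h2 =>
    refine ⟨i + 1, ?_⟩
    have hs := scale_pos i
    obtain ⟨I, hI, t, hy, ⟨rfl, ht⟩ | ⟨rfl, ht⟩⟩ := hg.exists_param y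
    · have h3 : 1 / 5 ≤ t := by by_contra! hc; nlinarith
      have h4 : t ≤ 2 / 5 := by by_contra! hc; nlinarith
      rw [← hy]
      exact ((config i).nextColour_param hI ⟨by linarith, by linarith⟩).1 ⟨h3, h4⟩
    · have h3 : 3 / 5 ≤ t := by by_contra! hc; nlinarith
      have h4 : t ≤ 4 / 5 := by by_contra! hc; nlinarith
      rw [← hy]
      exact ((config i).nextColour_param hI ⟨by linarith, by linarith⟩).2 ⟨h3, h4⟩
  | @right i _ a _ hg h1 h2 =>
    refine ⟨i + 1, ?_⟩
    have hs := scale_pos i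
    obtain ⟨I, hI, t, hy, ⟨rfl, ht⟩ | ⟨rfl, ht⟩⟩ := hg.exists_param y
    · have h3 : 3 / 5 ≤ t := by by_contra! hc; nlinarith
      have h4 : t ≤ 4 / 5 := by by_contra! hc; nlinarith
      rw [← hy]
      exact ((config i).nextColour_param hI ⟨by linarith, by linarith⟩).2 ⟨h3, h4⟩
    · have h3 : 1 / 5 ≤ t := by by_contra! hc; nlinarith
      have h4 : t ≤ 2 / 5 := by by_contra! hc; nlinarith
      rw [← hy]
      exact ((config i).nextColour_param hI ⟨by linarith, by linarith⟩).1 ⟨h3, h4⟩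

/-! ### Half-turn symmetry and the surroundings of a gap -/

theorem Gap.add_half {i : ℕ} {k : Colour} {a : ℝ} (h : Gap i k a) : Gap i k.swap (a + 1 / 2) := by
  induction h with
  | red n =>
    have := Gap.blue n
    rwa [show (3 / 4 + n : ℝ) = 1 / 4 + n + 1 / 2 by ring] at this
  | blue n =>
    have := Gap.red (n + 1)
    rwa [show (1 / 4 + (n + 1 : ℤ) : ℝ) = 3 / 4 + n + 1 / 2 by push_cast; ring] at this
  | first _ ih => exact ih.first
  | middle _ ih => have := ih.middle; rwa [add_right_comm] at this
  | last _ ih => have := ih.last; rwa [add_right_comm] at this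

theorem Col.add_half {k : Colour} {y : ℝ} (h : Col k y) : Col k.swap (y + 1 / 2) := by
  cases h with
  | red n h1 h2 => exact .blue n (by linarith) (by linarith)
  | blue n h1 h2 =>
    exact .red (n + 1) (by push_cast; linarith) (by push_cast; linarith)
  | left hg h1 h2 => exact .left hg.add_half (by linarith) (by linarith)
  | right hg h1 h2 => exact .right hg.add_half (by linarith) (by linarith)

theorem Col.add_nat_half {k : Colour} {y : ℝ} (h : Col k y) (j : ℕ) :
    Col (Colour.swap^[j] k) (y + j / 2) := by
  induction j with
  | zero => simpa using h
  | succ j ih =>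
    rw [Function.iterate_succ_apply']
    have := ih.add_half
    rwa [show y + (j : ℝ) / 2 + 1 / 2 = y + ((j + 1 : ℕ) : ℝ) / 2 by push_cast; ring] at this

/-- The block bordering a gap is at least as long as the gap: it was created at the same level or at
an earlier one, where blocks are longer. -/
theorem Gap.col_left {i : ℕ} {k : Colour} {a y : ℝ} (h : Gap i k a) (h1 : a - scale i ≤ y)
    (h2 : y ≤ a) : Col k y := by
  induction h with
  | red n => rw [scale_zero] at h1; exact .red n (by linarith) (by linarith)
  | blue n => rw [scale_zero] at h1; exact .blue n (by linarith) (by linarith)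
  | @first i k a _ ih =>
    have := scale_pos i
    rw [scale_succ] at h1
    exact ih (by linarith) h2
  | middle hg _ =>
    rw [scale_succ] at h1
    exact .left hg (by linarith) h2
  | last hg _ =>
    rw [scale_succ] at h1
    exact .right hg (by linarith) h2

theorem Gap.col_right {i : ℕ} {k : Colour} {a y : ℝ} (h : Gap i k a) (h1 : a + scale i ≤ y)
    (h2 : y ≤ a + 2 * scale i) : Col k.swap y := by
  induction h with
  | red n =>
    rw [scale_zero] at h1 h2; exact .blue n (by linarith) (by linarith)
  | blue n =>
    rw [scale_zero] at h1 h2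
    exact .red (n + 1) (by push_cast; linarith) (by push_cast; linarith)
  | first hg _ =>
    rw [scale_succ] at h1 h2
    exact .left hg (by linarith) (by linarith)
  | middle hg _ =>
    rw [scale_succ] at h1 h2
    rw [Colour.swap_swap]
    exact .right hg (by linarith) (by linarith)
  | @last i k a _ ih =>
    have := scale_pos i
    rw [scale_succ] at h1 h2
    exact ih (by linarith) (by linarith)

/-- The middle child of a gap is the neighbour of both outer children; at level 0 the two families
of gaps are neighbours of each other. -/
theorem Gap.neighbour {i : ℕ} {k : Colour} {a : ℝ} (h : Gap i k a) :
    Gap i k.swap (a - 2 * scale i) ∨ Gap i k.swap (a + 2 * scale i) := by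
  cases h with
  | red n =>
    right
    have := Gap.blue n
    rwa [show (3 / 4 + n : ℝ) = 1 / 4 + n + 2 * scale 0 by rw [scale_zero]; ring] at this
  | blue n =>
    left
    have := Gap.red n
    rwa [show (1 / 4 + n : ℝ) = 3 / 4 + n - 2 * scale 0 by rw [scale_zero]; ring] at this
  | @first i _ _ hg =>
    right
    have := hg.middle
    rwa [show a + 2 / 5 * scale i = a + 2 * scale (i + 1) by rw [scale_succ]; ring] at this
  | @middle i k a hg =>
    left
    have := hg.first
    rwa [show a = a + 2 / 5 * scale i - 2 * scale (i + 1) by rw [scale_succ]; ring,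
      ← Colour.swap_swap k] at this
  | @last i k a hg =>
    left
    have := hg.middle
    rwa [show a + 2 / 5 * scale i = a + 4 / 5 * scale i - 2 * scale (i + 1) by
      rw [scale_succ]; ring] at this

/-! ### Steps below 1/4 -/

/-- A sequence with constant increments that avoids `[u, v]` and passes from below to above jumps
over `[u, v]` in one step. -/
theorem exists_jump {z d u v : ℝ} (n : ℕ) (h0 : z < u) (hn : v < z + n * d) (huv : u ≤ v)
    (h : ∀ j : ℕ, j ≤ n → u ≤ z + j * d → v < z + j * d) :
    ∃ j : ℕ, j < n ∧ z + j * d < u ∧ v < z + (j + 1) * d := by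
  induction n with
  | zero => simp at hn; linarith
  | succ n ih =>
    by_cases hc : z + n * d < u
    · exact ⟨n, by omega, hc, by simpa using hn⟩
    · obtain ⟨j, hj, h1⟩ := ih (h n (by omega) (not_lt.mp hc)) fun j hj => h j (by omega)
      exact ⟨j, by omega, h1⟩

/-- Steps shorter than `v - u` cannot jump over `[u, v]`. -/
theorem lt_of_avoids {z d u v : ℝ} (n : ℕ) (hn : v < z + n * d) (huv : u ≤ v) (hd : d ≤ v - u)
    (h : ∀ j : ℕ, j ≤ n → u ≤ z + j * d → v < z + j * d) : v < z := by
  by_contra! hc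
  have h0 : z < u := by
    by_contra! hzu
    have := h 0 (by omega) (by simpa using hzu)
    simp at this
    linarith
  obtain ⟨j, -, h1, h2⟩ := exists_jump n h0 hn huv h
  linarith

/-- A progression of length 14 and step at least `l / 5` does not fit into `(a, a + 3 l)` minus
two suitably placed intervals. -/
theorem not_fits {z d a l : ℝ} (hl : 0 < l) (hd : l / 5 ≤ d) (h0 : a < z)
    (h13 : z + 13 * d < a + 3 * l)
    (h1 : ∀ j : ℕ, j < 14 → a + 3 / 5 * l ≤ z + j * d → a + 4 / 5 * l < z + j * d)
    (h2 : ∀ j : ℕ, j < 14 → a + 11 / 5 * l ≤ z + j * d → a + 12 / 5 * l < z + j * d) : False := by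
  obtain ⟨m, hm, hm1, hm2⟩ := exists_jump (z := z) (d := d) (u := a + 3 / 5 * l)
    (v := a + 4 / 5 * l) 13 (by linarith) (by norm_num; linarith) (by linarith)
    fun j hj => h1 j (by omega)
  obtain ⟨k, hk, hk1, hk2⟩ := exists_jump (z := z) (d := d) (u := a + 11 / 5 * l)
    (v := a + 12 / 5 * l) 13 (by linarith) (by norm_num; linarith) (by linarith)
    fun j hj => h2 j (by omega)
  -- Since `z > a` and `d ≥ l / 5`, the term `z + 3 * d` is already beyond `a + 3 / 5 * l`.
  have hm3 : m < 3 := by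
    by_contra! hc
    have : (3 : ℝ) ≤ m := by exact_mod_cast hc
    nlinarith
  -- The terms between the jumps give `(k - m - 1) * d < 7 / 5 * l`, and the terms around them `(k -
  -- m + 1) * d > 9 / 5 * l`. With `l / 5 ≤ d < 3 / 13 * l` this forces `k - m = 7`, hence `d > 9 /
  -- 40 * l`. Then at most two steps fit after the second jump, so `k ≥ 10` and `m ≥ 3`, a
  -- contradiction.
  interval_cases m <;> interval_cases k <;> norm_num at hm1 hm2 hk1 hk2 <;> linarith

/-- Two points at distance less than `scale i`, no colour of which is shared, straddle part of an
uncoloured interval of level `i`. -/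
theorem exists_straddled_gap {x y : ℝ} (hxy : x < y) (h : ∀ k, Col k x → ¬ Col k y) (i : ℕ)
    (hi : y - x < scale i) : ∃ k a, Gap i k a ∧ x < a + scale i ∧ a < y := by
  induction i with
  | zero =>
    rw [scale_zero] at hi ⊢
    have hf := Int.floor_le x
    have hf' := Int.lt_floor_add_one x
    by_cases h1 : x < ⌊x⌋ + 1 / 2
    · refine ⟨_, _, Gap.red ⌊x⌋, by linarith, ?_⟩
      by_contra! hc
      exact h _ (.red ⌊x⌋ hf (by linarith)) (.red ⌊x⌋ (by linarith) (by linarith))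
    · refine ⟨_, _, Gap.blue ⌊x⌋, by linarith, ?_⟩
      by_contra! hc
      exact h _ (.blue ⌊x⌋ (by linarith) (by linarith)) (.blue ⌊x⌋ (by linarith) (by linarith))
  | succ i ih =>
    have hs := scale_pos i
    rw [scale_succ] at hi ⊢
    obtain ⟨k, a, hg, h1, h2⟩ := ih (by linarith)
    -- If `x` and `y` straddle none of the three children, both lie in the same coloured block of
    -- the parent and share its colour.
    by_contra! hc
    have hx1 : a + scale i / 5 ≤ x := by
      by_contra! hx
      linarith [hc _ _ hg.first hx]
    have hy1 : y ≤ a + 4 / 5 * scale i := hc _ _ hg.last (by linarith)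
    by_cases hx2 : x < a + 3 / 5 * scale i
    · have hy2 := hc _ _ hg.middle (by linarith)
      exact h _ (.left hg (by linarith) (by linarith)) (.left hg (by linarith) (by linarith))
    · exact h _ (.right hg (by linarith) (by linarith)) (.right hg (by linarith) (by linarith))

/-- The straddled gap is either oriented like the progression, with `k` on its left, or against it.
In the first case the side of its neighbour decides which half of the progression is trapped in a
window of length `3 * scale i`; in the second the first half is trapped in the gap itself. -/
theorem no_ap_small {k : Colour} {x d : ℝ} (hd0 : 0 < d) (hd1 : d < 1 / 4)
    (hf : ∀ j : ℕ, j < 14 → ¬ Col k.swap (x + j * d))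
    (hl : ∀ j : ℕ, j < 14 → ¬ Col k (x + 14 * d + j * d)) : False := by
  obtain ⟨i, hi, hi'⟩ := exists_scale_le_lt hd0 hd1
  have hs := scale_pos i
  have h13 := hf 13 (by norm_num)
  have h14 := hl 0 (by norm_num)
  norm_num at h13 h14
  obtain ⟨c, a, hg, hx, hy⟩ := exists_straddled_gap (x := x + 13 * d) (y := x + 14 * d)
    (by linarith) (by
      intro c h h'
      rcases k.eq_or_eq_swap c with rfl | rfl
      · exact h14 h'
      · exact h13 h) i (by linarith)
  rw [scale_succ] at hi
  rcases k.eq_or_eq_swap c with rfl | rfl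
  · rcases hg.neighbour with hn | hn
    · have hlow : a - 2 * scale i < x := by
        refine lt_of_avoids (u := a - 3 * scale i) (d := d) 13 (by norm_num; linarith)
          (by linarith) (by linarith) fun j hj h => ?_
        by_contra! hc
        exact hf j (by omega) (hn.col_left (by linarith) hc)
      -- The window starts at the left neighbour `a - 2 * scale i`; the two obstacles are the blocks
      -- of colour `c.swap` inside the two gaps.
      refine not_fits hs hi hlow (by linarith) (fun j hj h => ?_) fun j hj h => ?_
      · by_contra! hc
        exact hf j hj (.right hn h hc)
      · by_contra! hc
        exact hf j hj (.left hg (by linarith) (by linarith))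
    · have hupp : x + 14 * d + 13 * d < a + 3 * scale i := by
        -- The upper bound is the lower bound for the reflected progression, whose term `j` is the
        -- term `13 - j` of the last half.
        have := lt_of_avoids (z := -(x + 14 * d + 13 * d)) (u := -(a + 4 * scale i))
          (v := -(a + 3 * scale i)) (d := d) 13 (by norm_num; linarith)
          (by linarith) (by linarith) fun j hj h => ?_
        · linarith
        by_contra! hc
        have hcol : Col c (x + 14 * d + (13 - j : ℕ) * d) := by
          rw [← c.swap_swap]
          push_cast [hj]
          exact hn.col_right (by linarith) (by linarith)
        exact hl _ (by omega) hcol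
      refine not_fits hs hi hy hupp (fun j hj h => ?_) fun j hj h => ?_
      · by_contra! hc
        exact hl j hj (.right hg h hc)
      · by_contra! hc
        refine hl j hj ?_
        rw [← c.swap_swap]
        exact .left hn (by linarith) (by linarith)
  -- Here the block left of the gap is forbidden to the first half, which therefore lies inside the
  -- gap; but `13 * d` exceeds `scale i`.
  · have hlow : a < x := by
      refine lt_of_avoids (u := a - scale i) (d := d) 13 ?_
          (by linarith) (by linarith) fun j hj h => ?_
      · by_contra! hc
        norm_num at hc
        exact h13 (hg.col_left (by linarith) hc)
      · by_contra! hc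
        exact hf j (by omega) (hg.col_left (by linarith) hc)
    linarith

/-! ### Steps from 1/4 to 3/8 -/

theorem exists_int_of_not_blue {y : ℝ} (h : ¬ Col .blue y) :
    ∃ n : ℤ, n + 3 / 4 < y ∧ y < n + 3 / 2 := by
  have h1 := Int.floor_le (y - 3 / 4)
  have h2 := Int.lt_floor_add_one (y - 3 / 4)
  refine ⟨⌊y - 3 / 4⌋, ?_, ?_⟩
  · by_contra! hc
    exact h (.blue ⌊y - 3 / 4⌋ (by linarith) hc)
  · by_contra! hc
    exact h (.blue (⌊y - 3 / 4⌋ + 1) (by push_cast; linarith) (by push_cast; linarith))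

theorem exists_int_of_not_red {y : ℝ} (h : ¬ Col .red y) :
    ∃ n : ℤ, n + 1 / 4 < y ∧ y < n + 1 := by
  have h1 := Int.floor_le y
  have h2 := Int.lt_floor_add_one y
  refine ⟨⌊y⌋, ?_, h2⟩
  by_contra! hc
  exact h (.red ⌊y⌋ h1 (by linarith))

/-- Three consecutive terms are spaced by roughly a third of the circle and drift slowly as the
progression goes on. To avoid a block of length `1/4`, they must have it nearly centred between two
of them. The blue and red blocks are half a turn apart, and the drift allowed by the first 14 terms
is too small to pass from one position to the other by terms 14, 15 and 16. -/
theorem no_ap_medium_red {x d : ℝ} (hd0 : 1 / 4 ≤ d) (hd1 : d ≤ 3 / 8)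
    (hf : ∀ j : ℕ, j < 14 → ¬ Col .blue (x + j * d))
    (hl : ∀ j : ℕ, j < 14 → ¬ Col .red (x + 14 * d + j * d)) : False := by
  have hf' : ∀ j : ℕ, ∃ n : ℤ, j < 14 → n + 3 / 4 < x + j * d ∧ x + j * d < n + 3 / 2 := by
    intro j
    by_cases hj : j < 14
    · obtain ⟨n, hn⟩ := exists_int_of_not_blue (hf j hj)
      exact ⟨n, fun _ => hn⟩
    · exact ⟨0, fun h => absurd h hj⟩
  choose n hn using hf'
  -- The integer `n j` numbers the blue-free interval, of length `3/4`, that contains term `j`.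
  -- Three steps have total length between `3/4` and `9/8`, so they lead to the next such interval.
  have hstep : ∀ j, j + 3 < 14 → n (j + 3) = n j + 1 := by
    intro j hj
    obtain ⟨h1, h2⟩ := hn j (by omega)
    obtain ⟨h3, h4⟩ := hn (j + 3) hj
    push_cast at h3 h4
    have h5 : (n (j + 3) : ℝ) < ((n j + 2 : ℤ) : ℝ) := by push_cast; linarith
    have h6 : ((n j : ℤ) : ℝ) < n (j + 3) := by linarith
    have h5' := Int.cast_lt.mp h5
    have h6' := Int.cast_lt.mp h6
    omega
  obtain ⟨m, hm1, hm2⟩ := exists_int_of_not_red (hl 0 (by norm_num))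
  obtain ⟨m', hm1', hm2'⟩ := exists_int_of_not_red (hl 1 (by norm_num))
  obtain ⟨m'', hm1'', hm2''⟩ := exists_int_of_not_red (hl 2 (by norm_num))
  have e3 := hstep 0 (by norm_num)
  have e6 := hstep 3 (by norm_num)
  have e9 := hstep 6 (by norm_num)
  have e12 := hstep 9 (by norm_num)
  have e4 := hstep 1 (by norm_num)
  have e7 := hstep 4 (by norm_num)
  have e10 := hstep 7 (by norm_num)
  have e13 := hstep 10 (by norm_num)
  have e5 := hstep 2 (by norm_num)
  have e8 := hstep 5 (by norm_num)
  have e11 := hstep 8 (by norm_num)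
  norm_num at e3 e6 e9 e12 e4 e7 e10 e13 e5 e8 e11
  have f12 : n 12 = n 0 + 4 := by omega
  have f13 : n 13 = n 1 + 4 := by omega
  have f11 : n 11 = n 2 + 3 := by omega
  have n0 := hn 0 (by norm_num)
  have n1 := hn 1 (by norm_num)
  have n2 := hn 2 (by norm_num)
  have n11 := hn 11 (by norm_num)
  have n12 := hn 12 (by norm_num)
  have n13 := hn 13 (by norm_num)
  rw [f11] at n11
  rw [f12] at n12
  rw [f13] at n13
  norm_num at n0 n1 n2 n11 n12 n13 hm1 hm2 hm1' hm2' hm1'' hm2''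
  have a1 : n 1 = n 0 ∨ n 1 = n 0 + 1 := by
    have h5 : (n 1 : ℝ) < ((n 0 + 2 : ℤ) : ℝ) := by push_cast; linarith
    have h6 : ((n 0 - 1 : ℤ) : ℝ) < n 1 := by push_cast; linarith
    have h5' := Int.cast_lt.mp h5
    have h6' := Int.cast_lt.mp h6
    omega
  have a2 : n 2 = n 1 ∨ n 2 = n 1 + 1 := by
    have h5 : (n 2 : ℝ) < ((n 1 + 2 : ℤ) : ℝ) := by push_cast; linarith
    have h6 : ((n 1 - 1 : ℤ) : ℝ) < n 2 := by push_cast; linarith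
    have h5' := Int.cast_lt.mp h5
    have h6' := Int.cast_lt.mp h6
    omega
  have b1 : m = n 1 + 5 := by
    have h5 : (m : ℝ) < ((n 1 + 6 : ℤ) : ℝ) := by push_cast; linarith
    have h6 : ((n 1 + 4 : ℤ) : ℝ) < m := by push_cast; linarith
    have h5' := Int.cast_lt.mp h5
    have h6' := Int.cast_lt.mp h6
    omega
  have b2 : m' = m ∨ m' = m + 1 := by
    have h5 : (m' : ℝ) < ((m + 2 : ℤ) : ℝ) := by push_cast; linarith
    have h6 : ((m - 1 : ℤ) : ℝ) < m' := by push_cast; linarith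
    have h5' := Int.cast_lt.mp h5
    have h6' := Int.cast_lt.mp h6
    omega
  have b3 : m'' = m' ∨ m'' = m' + 1 := by
    have h5 : (m'' : ℝ) < ((m' + 2 : ℤ) : ℝ) := by push_cast; linarith
    have h6 : ((m' - 1 : ℤ) : ℝ) < m'' := by push_cast; linarith
    have h5' := Int.cast_lt.mp h5
    have h6' := Int.cast_lt.mp h6
    omega
  -- All interval numbers are now determined by `n 0` and four binary choices; each choice leaves an
  -- inconsistent system of linear inequalities in `x`, `d` and `n 0`.
  have c1 := congrArg (Int.cast : ℤ → ℝ) b1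
  push_cast at c1
  rcases a1 with a1 | a1 <;> rcases a2 with a2 | a2 <;> rcases b2 with b2 | b2 <;>
    rcases b3 with b3 | b3 <;> replace a1 := congrArg (Int.cast : ℤ → ℝ) a1 <;>
    replace a2 := congrArg (Int.cast : ℤ → ℝ) a2 <;>
    replace b2 := congrArg (Int.cast : ℤ → ℝ) b2 <;>
    replace b3 := congrArg (Int.cast : ℤ → ℝ) b3 <;> push_cast at a1 a2 b2 b3 <;> linarith

/-! ### Steps between 3/8 and 1/2 -/

/-- Points of a progression with small step, no two consecutive ones sharing a colour: all of them
but the first and the last lie in one uncoloured interval. -/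
theorem exists_common_gap {x e : ℝ} (he : 0 < e)
    (h : ∀ j : ℕ, j < 13 → ∀ k, Col k (x - j * e) → ¬ Col k (x - (j + 1) * e)) (i : ℕ)
    (hi : 2 * e < scale i) :
    ∃ k a, Gap i k a ∧ x - e < a + scale i ∧ a < x - 12 * e := by
  -- A point in a block longer than `2 * e` has one of its two neighbours in the same block. The
  -- first and last points are excluded because they have only one neighbour.
  have avoid : ∀ u v : ℝ, ∀ k, 2 * e < v - u → (∀ y, u ≤ y → y ≤ v → Col k y) →
      ∀ j : ℕ, 1 ≤ j → j ≤ 12 → ¬ (u ≤ x - j * e ∧ x - j * e ≤ v) := by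
    rintro u v k huv hk j hj1 hj2 ⟨h1, h2⟩
    obtain ⟨j, rfl⟩ := Nat.exists_eq_add_of_le' hj1
    push_cast at h1 h2
    by_cases hc : x - j * e ≤ v
    · exact h j (by omega) k (hk _ (by linarith) hc) (hk _ (by linarith) h2)
    · refine h (j + 1) (by omega) k (hk _ ?_ ?_) (hk _ ?_ ?_) <;> push_cast <;> linarith
  -- The points descend by `e`, so they cannot leap over a block that they avoid: starting above its
  -- lower end, they all stay above its upper end.
  have jump : ∀ u v : ℝ, ∀ k, 2 * e < v - u → (∀ y, u ≤ y → y ≤ v → Col k y) →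
      u ≤ x - e → v < x - 12 * e := by
    intro u v k huv hk hu
    have key : ∀ j : ℕ, j < 12 → v < x - (j + 1) * e := by
      intro j hj
      induction j with
      | zero =>
        by_contra! hc
        refine avoid u v k huv hk 1 le_rfl (by norm_num) ⟨?_, ?_⟩ <;> norm_num at hc ⊢ <;> linarith
      | succ j ih =>
        have := ih (by omega)
        by_contra! hc
        refine avoid u v k huv hk (j + 2) (by omega) (by omega) ⟨?_, ?_⟩ <;> push_cast at hc ⊢ <;>
          linarith
    have := key 11 (by norm_num)
    norm_num at this
    exact this
  induction i with
  | zero =>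
    rw [scale_zero] at hi ⊢
    have hf := Int.floor_le (x - e)
    have hf' := Int.lt_floor_add_one (x - e)
    by_cases h1 : x - e < ⌊x - e⌋ + 1 / 2
    · have := jump ⌊x - e⌋ (⌊x - e⌋ + 1 / 4) .red (by linarith) (fun y => .red _) hf
      exact ⟨_, _, Gap.red ⌊x - e⌋, by linarith, by linarith⟩
    · have := jump (⌊x - e⌋ + 1 / 2) (⌊x - e⌋ + 3 / 4) .blue (by linarith) (fun y => .blue _)
        (by linarith)
      exact ⟨_, _, Gap.blue ⌊x - e⌋, by linarith, by linarith⟩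
  | succ i ih =>
    have hs := scale_pos i
    rw [scale_succ] at hi ⊢
    obtain ⟨k, a, hg, h1, h2⟩ := ih (by linarith)
    by_cases c1 : x - e < a + 1 / 5 * scale i
    · exact ⟨_, _, hg.first, by linarith, h2⟩
    have j1 := jump _ _ _ (by linarith) (fun y => Col.left hg) (not_lt.mp c1)
    by_cases c2 : x - e < a + 3 / 5 * scale i
    · exact ⟨_, _, hg.middle, by linarith, j1⟩
    have j2 := jump _ _ _ (by linarith) (fun y => Col.right hg) (not_lt.mp c2)
    exact ⟨_, _, hg.last, by linarith, j2⟩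

/-- With `e = 1/2 - d`, the point `x + j * d` is `x - j * e` after `j` half turns, so a colour
missing from the progression becomes an alternating missing colour. Twelve of these points lie in
one gap, giving `11 * e < scale i`, whereas the choice of `i` gives `scale i ≤ 10 * e`. -/
theorem no_ap_large {k : Colour} {x d : ℝ} (hd0 : 3 / 8 < d) (hd1 : d < 1 / 2)
    (hf : ∀ j : ℕ, j < 14 → ¬ Col k (x + j * d)) : False := by
  obtain ⟨i, hi, hi'⟩ := exists_scale_le_lt (d := 2 * (1 / 2 - d)) (by linarith) (by linarith)
  obtain ⟨c, a, -, h1, h2⟩ := exists_common_gap (x := x) (e := 1 / 2 - d) (by linarith) (by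
    intro j hj c h h'
    have e1 := h.add_nat_half j
    have e2 := h'.add_nat_half (j + 1)
    rw [Function.iterate_succ_apply'] at e2
    rw [show x - j * (1 / 2 - d) + (j : ℝ) / 2 = x + j * d by ring] at e1
    rw [show x - (j + 1) * (1 / 2 - d) + ((j + 1 : ℕ) : ℝ) / 2 = x + (j + 1 : ℕ) * d by
      push_cast; ring] at e2
    rcases (Colour.swap^[j] c).eq_or_eq_swap k with h3 | h3
    · rw [← h3] at e1
      exact hf j (by omega) e1
    · rw [← h3] at e2
      exact hf (j + 1) (by omega) e2) i hi'
  rw [scale_succ] at hi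
  linarith

theorem no_ap_medium {k : Colour} {x d : ℝ} (hd0 : 1 / 4 ≤ d) (hd1 : d ≤ 3 / 8)
    (hf : ∀ j : ℕ, j < 14 → ¬ Col k.swap (x + j * d))
    (hl : ∀ j : ℕ, j < 14 → ¬ Col k (x + 14 * d + j * d)) : False := by
  cases k with
  | red => exact no_ap_medium_red hd0 hd1 hf hl
  | blue =>
    refine no_ap_medium_red (x := x - 1 / 2) hd0 hd1 (fun j hj h => hf j hj ?_)
      fun j hj h => hl j hj ?_
    · have := h.add_half
      rwa [show x - 1 / 2 + j * d + 1 / 2 = x + j * d by ring] at this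
    · have := h.add_half
      rwa [show x - 1 / 2 + 14 * d + j * d + 1 / 2 = x + 14 * d + j * d by ring] at this

theorem no_ap {k : Colour} {x d : ℝ} (hd0 : 0 < d) (hd1 : d < 1 / 2)
    (hf : ∀ j : ℕ, j < 14 → ¬ Col k.swap (x + j * d))
    (hl : ∀ j : ℕ, j < 14 → ¬ Col k (x + 14 * d + j * d)) : False := by
  rcases lt_or_ge d (1 / 4) with h | h
  · exact no_ap_small hd0 h hf hl
  rcases le_or_gt d (3 / 8) with h' | h'
  · exact no_ap_medium h h' hf hl
  · exact no_ap_large h' hd1 hf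

/-! ### Transfer to the circle and to residues modulo p -/

theorem not_hasPartialAP_limitColour {d : ℝ}
    (hd : d ∈ Set.Ioo (-1 / 2 : ℝ) 0 ∪ Set.Ioo (0 : ℝ) (1 / 2)) :
    ¬ HasPartialAP limitColour 14 14 (d : UnitAddCircle) := by
  rintro ⟨x, hr, hb⟩
  obtain ⟨x, -, rfl⟩ := exists_rep x
  have hcoe : ∀ i : ℕ, (x : UnitAddCircle) + i • (d : UnitAddCircle) = ((x + i * d : ℝ)) := by
    intro i
    rw [AddCircle.coe_add, ← nsmul_eq_mul, AddCircle.coe_nsmul]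
  have hr' : ∀ i : ℕ, i < 14 → ¬ Col .blue (x + i * d) := fun i hi h =>
    hr i hi (by rw [hcoe]; exact h.limitColour_eq)
  have hb' : ∀ i : ℕ, 14 ≤ i → i < 28 → ¬ Col .red (x + i * d) := fun i hi hi' h =>
    hb i hi hi' (by rw [hcoe]; exact h.limitColour_eq)
  rcases hd with ⟨h1, h2⟩ | ⟨h1, h2⟩
  -- For a negative step the progression is read backwards, starting with its blue half.
  · refine no_ap (k := .blue) (x := x + 27 * d) (d := -d) (by linarith) (by linarith)
      (fun j hj h => hb' (27 - j) (by omega) (by omega) ?_)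
      fun j hj h => hr' (13 - j) (by omega) ?_
    · have : ((27 - j : ℕ) : ℝ) = 27 - j := by rw [Nat.cast_sub (by omega)]; norm_num
      rw [this]
      rwa [show x + 27 * d + j * -d = x + (27 - j) * d by ring] at h
    · have : ((13 - j : ℕ) : ℝ) = 13 - j := by rw [Nat.cast_sub (by omega)]; norm_num
      rw [this]
      rwa [show x + 27 * d + 14 * -d + j * -d = x + (13 - j) * d by ring] at h
  · refine no_ap (k := .red) (x := x) h1 h2 hr' fun j hj h => hb' (14 + j) (by omega) (by omega) ?_
    push_cast
    rwa [show x + 14 * d + j * d = x + (14 + j) * d by ring] at h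

theorem not_hasAP_of_extends {c' : UnitAddCircle → Colour} (hc : Extends c' limitColour)
    (d : UnitAddCircle) : ¬ HasAP c' 14 14 d := by
  intro hap
  obtain ⟨y, hy, rfl⟩ : ∃ y ∈ Set.Ioc (-1 / 2 : ℝ) (1 / 2), (y : UnitAddCircle) = d := by
    obtain ⟨y, hy, rfl⟩ := (AddCircle.coe_image_Ioc_eq (1 : ℝ) (-1 / 2)).ge (Set.mem_univ d)
    exact ⟨y, ⟨hy.1, by linarith [hy.2]⟩, rfl⟩
  have hmem : y ∈ Set.Ioo (-1 / 2 : ℝ) 0 ∪ Set.Ioo (0 : ℝ) (1 / 2) := by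
    -- If `14 * y` were an integer, terms 0 and 14 would be the same point, both red and blue. This
    -- rules out the steps `0` and `1/2`.
    have hne : ∀ n : ℤ, 14 * y ≠ n := by
      intro n hn
      obtain ⟨x, hr, hb⟩ := hap
      have h0 := hr 0 (by norm_num)
      have h14 := hb 14 le_rfl (by norm_num)
      have : (14 : ℕ) • (y : UnitAddCircle) = 0 := by
        rw [← AddCircle.coe_nsmul, nsmul_eq_mul]
        have := coe_add_intCast 0 n
        rw [zero_add, ← hn] at this
        simpa using this
      rw [this] at h14
      rw [zero_smul, h14] at h0
      cases h0
    have h0 : y ≠ 0 := fun h => hne 0 (by simp [h])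
    have h1 : y ≠ 1 / 2 := fun h => hne 7 (by rw [h]; norm_num)
    rcases h0.lt_or_gt with h | h
    · exact Or.inl ⟨hy.1, h⟩
    · exact Or.inr ⟨h, lt_of_le_of_ne hy.2 h1⟩
  refine not_hasPartialAP_limitColour hmem ?_
  obtain ⟨x, hr, hb⟩ := hap
  refine ⟨x, fun i hi h => ?_, fun i hi hi' h => ?_⟩
  · have := hr i hi
    rw [hc _ _ h] at this
    cases this
  · have := hb i hi hi'
    rw [hc _ _ h] at this
    cases this

theorem induced_eq (p : ℕ) [NeZero p] (c : UnitAddCircle → Colour) (x : ZMod p) :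
    induced p c x = c (ZMod.toAddCircle x) := by
  rw [induced, ZMod.toAddCircle_apply]

theorem not_hasAP_induced {c' : UnitAddCircle → Colour} (hc : Extends c' limitColour) {p : ℕ}
    (hp : p ≠ 0) (d : ZMod p) : ¬ HasAP (induced p c') 14 14 d := by
  have : NeZero p := ⟨hp⟩
  rintro ⟨x, hr, hb⟩
  refine not_hasAP_of_extends hc (ZMod.toAddCircle d)
    ⟨ZMod.toAddCircle x, fun i hi => ?_, fun i hi hi' => ?_⟩
  · rw [← map_nsmul, ← map_add, ← induced_eq p c']
    exact hr i hi
  · rw [← map_nsmul, ← map_add, ← induced_eq p c']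
    exact hb i hi hi'

/-! ### Colour densities -/

/-- At least `A` integers `j` have the property that `j / p` lies in `s` and has colour `k`. -/
def Many (p : ℕ) (k : Colour) (s : Set ℝ) (A : ℝ) : Prop :=
  ∃ S : Finset ℤ, (∀ j ∈ S, (j / p : ℝ) ∈ s ∧ Col k (j / p)) ∧ A ≤ S.card

theorem Many.mono {p : ℕ} {k : Colour} {s t : Set ℝ} {A B : ℝ} (h : Many p k s A) (hst : s ⊆ t)
    (hAB : B ≤ A) : Many p k t B := by
  obtain ⟨S, hS, hA⟩ := h
  exact ⟨S, fun j hj => ⟨hst (hS j hj).1, (hS j hj).2⟩, hAB.trans hA⟩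

theorem Many.union {p : ℕ} {k : Colour} {s t : Set ℝ} {A B : ℝ} (hs : Many p k s A)
    (ht : Many p k t B) (hst : ∀ x ∈ s, ∀ y ∈ t, x < y) : Many p k (s ∪ t) (A + B) := by
  obtain ⟨S, hS, hA⟩ := hs
  obtain ⟨T, hT, hB⟩ := ht
  refine ⟨S ∪ T, fun j hj => ?_, ?_⟩
  · rcases Finset.mem_union.mp hj with h | h
    · exact ⟨Or.inl (hS j h).1, (hS j h).2⟩
    · exact ⟨Or.inr (hT j h).1, (hT j h).2⟩
  · rw [Finset.card_union_of_disjoint]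
    · push_cast; linarith
    · rw [Finset.disjoint_left]
      intro j h1 h2
      exact lt_irrefl _ (hst _ (hS j h1).1 _ (hT j h2).1)

theorem many_zero (p : ℕ) (k : Colour) (s : Set ℝ) : Many p k s 0 := ⟨∅, by simp, by simp⟩

theorem many_Icc {p : ℕ} (hp : 0 < p) {k : Colour} {u v : ℝ}
    (h : ∀ y, u ≤ y → y ≤ v → Col k y) : Many p k (Set.Icc u v) (p * (v - u) - 1) := by
  have hp' : (0 : ℝ) < p := by exact_mod_cast hp
  refine ⟨Finset.Icc ⌈u * p⌉ ⌊v * p⌋, fun j hj => ?_, ?_⟩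
  · rw [Finset.mem_Icc, Int.ceil_le, Int.le_floor] at hj
    have h1 : u ≤ j / p := (le_div_iff₀ hp').mpr hj.1
    have h2 : (j / p : ℝ) ≤ v := (div_le_iff₀ hp').mpr hj.2
    exact ⟨⟨h1, h2⟩, h _ h1 h2⟩
  · rw [Int.card_Icc]
    have h1 := Int.ceil_lt_add_one (u * p)
    have h2 := Int.lt_floor_add_one (v * p)
    have h3 : ((⌊v * p⌋ + 1 - ⌈u * p⌉ : ℤ) : ℝ) ≤ ((⌊v * p⌋ + 1 - ⌈u * p⌉).toNat : ℝ) := by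
      exact_mod_cast Int.self_le_toNat _
    push_cast at h3
    linarith

/-- After `m` rounds a fraction `(3/5)^m` of the gap is uncoloured and half of the rest has colour
`k`. That half consists of `1 + 3 + ... + 3^(m-1) = (3^m - 1) / 2` blocks, each costing at most 1 in
the count of multiples of `1/p`. -/
theorem Gap.many {p : ℕ} (hp : 0 < p) (k : Colour) (m : ℕ) :
    ∀ {i : ℕ} {l : Colour} {a : ℝ}, Gap i l a → Many p k (Set.Ioo a (a + scale i))
      (p * scale i * ((1 - (3 / 5) ^ m) / 2) - (3 ^ m - 1) / 2) := by
  induction m with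
  | zero => intro i l a _; simpa using many_zero p k _
  | succ m ih =>
    intro i l a hg
    have hs := scale_pos i
    have h1 := ih hg.first
    have h2 := ih hg.middle
    have h3 := ih hg.last
    rw [scale_succ] at h1 h2 h3
    rcases l.eq_or_eq_swap k with rfl | rfl
    · have h4 := many_Icc hp fun y => Col.right hg
      refine (((h1.union h2 ?_).union h4 ?_).union h3 ?_).mono ?_ (le_of_eq ?_)
      · rintro x ⟨hx, hx'⟩ y ⟨hy, hy'⟩; linarith
      · rintro x (⟨hx, hx'⟩ | ⟨hx, hx'⟩) y ⟨hy, hy'⟩ <;> linarith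
      · rintro x ((⟨hx, hx'⟩ | ⟨hx, hx'⟩) | ⟨hx, hx'⟩) y ⟨hy, hy'⟩ <;> linarith
      · rintro x (((⟨hx, hx'⟩ | ⟨hx, hx'⟩) | ⟨hx, hx'⟩) | ⟨hx, hx'⟩) <;> constructor <;> linarith
      · ring
    · have h4 := many_Icc hp fun y => Col.left hg
      refine (((h1.union h4 ?_).union h2 ?_).union h3 ?_).mono ?_ (le_of_eq ?_)
      · rintro x ⟨hx, hx'⟩ y ⟨hy, hy'⟩; linarith
      · rintro x (⟨hx, hx'⟩ | ⟨hx, hx'⟩) y ⟨hy, hy'⟩ <;> linarith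
      · rintro x ((⟨hx, hx'⟩ | ⟨hx, hx'⟩) | ⟨hx, hx'⟩) y ⟨hy, hy'⟩ <;> linarith
      · rintro x (((⟨hx, hx'⟩ | ⟨hx, hx'⟩) | ⟨hx, hx'⟩) | ⟨hx, hx'⟩) <;> constructor <;> linarith
      · ring

theorem many_Ico {p : ℕ} (hp : 0 < p) (k : Colour) (m : ℕ) :
    Many p k (Set.Ico 0 1) (p * (1 / 2 - (3 / 5) ^ m / 4) - 3 ^ m) := by
  have g1 := (Gap.red 0).many hp k m
  have g2 := (Gap.blue 0).many hp k m
  norm_num [scale_zero] at g1 g2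
  cases k with
  | red =>
    have h := many_Icc hp fun y => Col.red (y := y) 0
    norm_num at h
    refine ((h.union g1 ?_).union g2 ?_).mono ?_ (le_of_eq ?_)
    · rintro x ⟨hx, hx'⟩ y ⟨hy, hy'⟩; linarith
    · rintro x (⟨hx, hx'⟩ | ⟨hx, hx'⟩) y ⟨hy, hy'⟩ <;> linarith
    · rintro x ((⟨hx, hx'⟩ | ⟨hx, hx'⟩) | ⟨hx, hx'⟩) <;> constructor <;> linarith
    · ring
  | blue =>
    have h := many_Icc hp fun y => Col.blue (y := y) 0
    norm_num at h
    refine ((g1.union h ?_).union g2 ?_).mono ?_ (le_of_eq ?_)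
    · rintro x ⟨hx, hx'⟩ y ⟨hy, hy'⟩; linarith
    · rintro x (⟨hx, hx'⟩ | ⟨hx, hx'⟩) y ⟨hy, hy'⟩ <;> linarith
    · rintro x ((⟨hx, hx'⟩ | ⟨hx, hx'⟩) | ⟨hx, hx'⟩) <;> constructor <;> linarith
    · ring

theorem le_card_induced {c' : UnitAddCircle → Colour} (hc : Extends c' limitColour) {p : ℕ}
    (hp : 0 < p) {k : Colour} {A : ℝ} (h : Many p k (Set.Ico 0 1) A) :
    A ≤ Nat.card {x : ZMod p // induced p c' x = k} := by
  classical
  have : NeZero p := ⟨hp.ne'⟩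
  have hp' : (0 : ℝ) < p := by exact_mod_cast hp
  obtain ⟨S, hS, hA⟩ := h
  refine hA.trans ?_
  have hval : ∀ j ∈ S, (((j : ZMod p).val : ℕ) : ℤ) = j := by
    intro j hj
    obtain ⟨h0, h1⟩ := (hS j hj).1
    have h0' : (0 : ℝ) ≤ j := by
      by_contra! hn
      exact absurd h0 (not_le.mpr (div_neg_of_neg_of_pos hn hp'))
    have h1' : (j : ℝ) < p := by rwa [div_lt_one hp'] at h1
    rw [ZMod.val_intCast]
    exact Int.emod_eq_of_lt (by exact_mod_cast h0') (by exact_mod_cast h1')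
  rw [Nat.card_eq_fintype_card, Fintype.card_subtype]
  norm_cast
  refine Finset.card_le_card_of_injOn (fun j : ℤ => (j : ZMod p)) (fun j hj => ?_) ?_
  · simp only [Finset.coe_filter, Finset.mem_univ, true_and, Set.mem_ofPred_eq]
    refine hc _ _ ?_
    have : (((j : ZMod p).val : ℕ) : ℝ) = (j : ℝ) := by exact_mod_cast hval j hj
    rw [this]
    exact (hS j hj).2.limitColour_eq
  · intro i hi j hj hij
    rw [← hval i hi, ← hval j hj]
    exact congrArg (fun z : ZMod p => ((z.val : ℕ) : ℤ)) hij

theorem density_red_add_blue {p : ℕ} (hp : 0 < p) (c : ZMod p → Colour) :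
    density p c .red + density p c .blue = 1 := by
  classical
  have : NeZero p := ⟨hp.ne'⟩
  have hp' : (p : ℝ) ≠ 0 := by exact_mod_cast hp.ne'
  have h : ∀ x, c x = .blue ↔ ¬ c x = .red := by
    intro x; cases c x <;> simp
  unfold density
  rw [← add_div, div_eq_one_iff_eq hp']
  simp only [h, Nat.card_eq_fintype_card, Fintype.card_subtype]
  norm_cast
  rw [Finset.card_filter_add_card_filter_not, Finset.card_univ, ZMod.card]

theorem eventually_lt_density {c' : UnitAddCircle → Colour} (hc : Extends c' limitColour)
    (k : Colour) {δ : ℝ} (hδ : δ < 1 / 2) : ∀ᶠ p in atTop, δ < density p (induced p c') k := by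
  obtain ⟨m, hm⟩ := exists_pow_lt_of_lt_one (show (0 : ℝ) < 1 / 2 - δ by linarith)
    (by norm_num : (3 / 5 : ℝ) < 1)
  have h3 : Tendsto (fun p : ℕ => (3 : ℝ) ^ m / (p : ℝ)) atTop (𝓝 0) :=
    tendsto_const_div_atTop_nhds_zero_nat _
  filter_upwards [eventually_gt_atTop 0,
    h3.eventually (gt_mem_nhds (show (0 : ℝ) < (1 / 2 - δ) / 2 by linarith))] with p hp hlt
  have hp' : (0 : ℝ) < p := by exact_mod_cast hp
  have h := le_card_induced hc hp (many_Ico hp k m)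
  have h4 : (p * (1 / 2 - (3 / 5) ^ m / 4) - 3 ^ m) / p ≤ density p (induced p c') k :=
    div_le_div_of_nonneg_right h hp'.le
  rw [sub_div, mul_div_cancel_left₀ _ hp'.ne'] at h4
  linarith

theorem tendsto_density {c' : UnitAddCircle → Colour} (hc : Extends c' limitColour)
    (k : Colour) : Tendsto (fun p : ℕ => density p (induced p c') k) atTop (𝓝 (1 / 2)) := by
  refine tendsto_order.mpr ⟨fun δ hδ => eventually_lt_density hc k hδ, fun δ hδ => ?_⟩
  -- The upper bound for one colour is the lower bound for the other, as the two densities add up to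
  -- 1.
  filter_upwards [eventually_gt_atTop 0,
    eventually_lt_density hc k.swap (show 1 - δ < 1 / 2 by linarith)] with p hp h
  have := density_red_add_blue hp (induced p c')
  cases k <;> simp only [Colour.swap] at h <;> linarith

theorem exists_extends {X : Type*} (c : PartialColouring X) : ∃ c', Extends c' c :=
  ⟨fun x => (c x).getD .red, fun x k h => by simp [h]⟩

theorem not_findableAt {δ : ℝ} (hδ : δ < 1 / 2) : ¬ FindableAt δ 14 14 := by
  rintro ⟨p₀, h⟩
  obtain ⟨c', hc⟩ := exists_extends limitColour
  obtain ⟨N, hN⟩ := eventually_atTop.mp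
    ((eventually_lt_density hc .red hδ).and (eventually_lt_density hc .blue hδ))
  obtain ⟨p, hp, hpp⟩ := Nat.exists_infinite_primes (max p₀ N)
  have hp' : (0 : ℝ) < p := by exact_mod_cast hpp.pos
  obtain ⟨h1, h2⟩ := hN p ((le_max_right _ _).trans hp)
  obtain ⟨d, -, hd⟩ := h p hpp ((le_max_left _ _).trans hp) (induced p c') fun k => by
    rw [← le_div_iff₀ hp']
    cases k
    · exact h1.le
    · exact h2.le
  exact not_hasAP_induced hc hpp.ne_zero d hd

end FractalColouring

theorem mainTheorem2 :
    (∀ d : ℝ, d ∈ Set.Ioo (-1 / 2 : ℝ) 0 ∪ Set.Ioo (0 : ℝ) (1 / 2) →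
      ¬ FractalColouring.HasPartialAP FractalColouring.limitColour 14 14 (d : UnitAddCircle)) ∧
    (∀ c' : UnitAddCircle → FractalColouring.Colour,
      FractalColouring.Extends c' FractalColouring.limitColour →
        (∀ d : UnitAddCircle, ¬ FractalColouring.HasAP c' 14 14 d) ∧
        (∀ p : ℕ, p.Prime → ∀ d : ZMod p,
          ¬ FractalColouring.HasAP (FractalColouring.induced p c') 14 14 d) ∧
        (∀ k : FractalColouring.Colour,
          Tendsto (fun p : ℕ => FractalColouring.density p (FractalColouring.induced p c') k)
            (atTop ⊓ 𝓟 {p : ℕ | p.Prime}) (𝓝 (1 / 2)))) ∧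
    (∀ δ : ℝ, δ < 1 / 2 → ¬ FractalColouring.FindableAt δ 14 14) ∧
    ¬ FractalColouring.Findable 14 14 := by
  refine ⟨fun d => FractalColouring.not_hasPartialAP_limitColour, fun c' hc =>
    ⟨FractalColouring.not_hasAP_of_extends hc,
      fun p hp => FractalColouring.not_hasAP_induced hc hp.ne_zero,
      fun k => (FractalColouring.tendsto_density hc k).mono_left inf_le_left⟩,
    fun δ => FractalColouring.not_findableAt, fun h => ?_⟩
  exact FractalColouring.not_findableAt (by norm_num : (1 / 4 : ℝ) < 1 / 2) (h _ (by norm_num))
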